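/- Let $n\ge 3$ and $k\ge 1$ be integers, let $2^*=\frac{2n}{n-2}$, and let $\Theta\subset\mathbb R^n$ be a bounded smooth domain with $\overline\Theta\subset(0,\infty)\times\mathbb R^{n-1}$. Put $\alpha=\min_{x\in\overline\Theta}x_1$ and $\beta=\max_{x\in\overline\Theta}x_1$. For $\lambda\in\mathbb R$ and $u\in H_0^1(\Theta)$ let $$J_\lambda(u)=\frac12\int_\Theta x_1^k|\nabla u|^2-\frac{\lambda}{2}\int_\Theta x_1^k u^2-\frac1{2^*}\int_\Theta x_1^k|u|^{2^*},$$ let $\mathcal N_\lambda=\{u\in H_0^1(\Theta)\setminus\{0\}: J_\lambda'(u)u=0\}$ and $\ell_\lambda^{[k]}=\inf_{\mathcal N_\lambda}J_\lambda$. Let $\lambda_1^{[k]}$ be the first eigenvalue of the weak problem $-\mathrm{div}(x_1^k\nabla u)=\lambda x_1^k u$ in $\Theta$, $u\in H_0^1(\Theta)$; let $S$ be the best Sobolev constant, i.e. the infimum of $\int_{\mathbb R^n}|\nabla u|^2\big/\big(\int_{\mathbb R^n}|u|^{2^*}\big)^{2/2^*}$ over $u\in H^1(\mathbb R^n)\setminus\{0\}$;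 let $\kappa^{[k]}=\big(\min_{x\in\overline\Theta}x_1^k\big)\frac1n S^{n/2}$; and define $$\lambda_{0,*}^{[k]}=\inf\{\lambda\in(-\infty,\lambda_1^{[k]}):\ \ell_\lambda^{[k]}<\kappa^{[k]}\}.$$ Let $f\in C^2[\alpha,\beta]$ be a positive function such that $$\alpha^k f(\alpha)^2\le t^k f(t)^2\quad\text{and}\quad t^k f(t)^{2^*}\le\alpha^k f(\alpha)^{2^*}\qquad\text{for all }t\in[\alpha,\beta].$$ Then $$\lambda_{0,*}^{[k]}\ \ge\ \min_{t\in[\alpha,\beta]}\frac{-\left(t^k f'(t)\right)'}{t^k f(t)}.$$ -/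

import Mathlib

open MeasureTheory Set
open scoped ContDiff InnerProductSpace

noncomputable section

namespace AnisoCrit

/-- A bounded smooth domain in `ℝⁿ`: open, connected, nonempty, bounded, and near each boundary
point the sublevel set `{ρ < 0}` of a smooth function `ρ` with nonvanishing differential there. -/
structure IsBoundedSmoothDomain {n : ℕ} (Θ : Set (EuclideanSpace ℝ (Fin n))) : Prop where
  isOpen : IsOpen Θ
  isConnected : IsConnected Θ
  isBounded : Bornology.IsBounded Θ
  smooth_boundary : ∀ x ∈ frontier Θ, ∃ U : Set (EuclideanSpace ℝ (Fin n)),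
    ∃ ρ : EuclideanSpace ℝ (Fin n) → ℝ, IsOpen U ∧ x ∈ U ∧ ContDiff ℝ ∞ ρ ∧ fderiv ℝ ρ x ≠ 0 ∧
      ∀ y ∈ U, y ∈ Θ ↔ ρ y < 0

/-- `φ ∈ C_c^∞(Θ)`. -/
structure IsTestFunction {n : ℕ} (Θ : Set (EuclideanSpace ℝ (Fin n)))
    (φ : EuclideanSpace ℝ (Fin n) → ℝ) : Prop where
  contDiff : ContDiff ℝ ∞ φ
  hasCompactSupport : HasCompactSupport φ
  tsupport_subset : tsupport φ ⊆ Θ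

/-- The pairs `(φ, ∇φ)`, `φ ∈ C_c^∞(Θ)`, as a subspace of `L²(Θ) × L²(Θ; ℝⁿ)`. -/
def testPairs {n : ℕ} (Θ : Set (EuclideanSpace ℝ (Fin n))) :
    Submodule ℝ (Lp ℝ 2 (volume.restrict Θ) ×
      Lp (EuclideanSpace ℝ (Fin n)) 2 (volume.restrict Θ)) where
  carrier := {p | ∃ φ, IsTestFunction Θ φ ∧ p.1 =ᵐ[volume.restrict Θ] φ ∧
    p.2 =ᵐ[volume.restrict Θ] gradient φ}
  zero_mem' := by
    refine ⟨fun _ => 0, ⟨contDiff_const, HasCompactSupport.zero, ?_⟩, ?_, ?_⟩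
    · have h : tsupport (fun _ : EuclideanSpace ℝ (Fin n) => (0 : ℝ)) = ∅ := by
        rw [tsupport_eq_empty_iff]; rfl
      rw [h]; exact empty_subset _
    · exact Lp.coeFn_zero ℝ 2 (volume.restrict Θ)
    · refine (Lp.coeFn_zero (EuclideanSpace ℝ (Fin n)) 2 (volume.restrict Θ)).trans ?_
      refine Filter.Eventually.of_forall fun x => ?_
      simp [gradient]
  add_mem' := by
    rintro p q ⟨φ, hφ, h1, h2⟩ ⟨ψ, hψ, h3, h4⟩
    refine ⟨φ + ψ, ⟨hφ.contDiff.add hψ.contDiff, hφ.hasCompactSupport.add hψ.hasCompactSupport,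
      (tsupport_add φ ψ).trans (union_subset hφ.tsupport_subset hψ.tsupport_subset)⟩, ?_, ?_⟩
    · exact (Lp.coeFn_add p.1 q.1).trans (h1.add h3)
    · refine (Lp.coeFn_add p.2 q.2).trans ((h2.add h4).trans ?_)
      refine Filter.Eventually.of_forall fun x => ?_
      have e1 := (hφ.contDiff.differentiable (by simp)) x
      have e2 := (hψ.contDiff.differentiable (by simp)) x
      simp [gradient, fderiv_add e1 e2]
  smul_mem' := by
    rintro c p ⟨φ, hφ, h1, h2⟩
    refine ⟨c • φ, ⟨hφ.contDiff.const_smul c, hφ.hasCompactSupport.smul_left (f := fun _ => c),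
      (closure_mono (Function.support_const_smul_subset c φ)).trans hφ.tsupport_subset⟩, ?_, ?_⟩
    · exact (Lp.coeFn_smul c p.1).trans (h1.const_smul c)
    · refine (Lp.coeFn_smul c p.2).trans ((h2.const_smul c).trans ?_)
      refine Filter.Eventually.of_forall fun x => ?_
      have e1 := (hφ.contDiff.differentiable (by simp)) x
      simp [gradient, fderiv_const_smul e1 c]

/-- The Sobolev space `H_0^1(Θ)`: the closure of `C_c^∞(Θ)` in the `H^1` norm. An element is
recorded together with its weak gradient (which it determines). -/
def H10 {n : ℕ} (Θ : Set (EuclideanSpace ℝ (Fin n))) :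
    Submodule ℝ (Lp ℝ 2 (volume.restrict Θ) ×
      Lp (EuclideanSpace ℝ (Fin n)) 2 (volume.restrict Θ)) :=
  (testPairs Θ).topologicalClosure

/-- (A representative of) the function underlying an element of `H_0^1(Θ)`. -/
def valH {n : ℕ} {Θ : Set (EuclideanSpace ℝ (Fin n))} (u : H10 Θ) :
    EuclideanSpace ℝ (Fin n) → ℝ := u.1.1

/-- (A representative of) the weak gradient of an element of `H_0^1(Θ)`. -/
def gradH {n : ℕ} {Θ : Set (EuclideanSpace ℝ (Fin n))} (u : H10 Θ) :
    EuclideanSpace ℝ (Fin n) → EuclideanSpace ℝ (Fin n) := u.1.2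

/-- The critical Sobolev exponent `2^* = 2n/(n-2)`. -/
def critExp (n : ℕ) : ℝ := 2 * n / (n - 2)

/-- The functional
`J_λ(u) = 1/2 ∫ a |∇u|² - λ/2 ∫ b u² - 1/2^* ∫ c |u|^{2^*}` on `H_0^1(Θ)`. -/
def J {n : ℕ} (Θ : Set (EuclideanSpace ℝ (Fin n))) (a b c : EuclideanSpace ℝ (Fin n) → ℝ)
    (lam : ℝ) (u : H10 Θ) : ℝ :=
  1 / 2 * (∫ x in Θ, a x * ‖gradH u x‖ ^ 2) - lam / 2 * (∫ x in Θ, b x * valH u x ^ 2)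
    - 1 / critExp n * (∫ x in Θ, c x * |valH u x| ^ critExp n)

/-- The (usual) Nehari manifold `{u ∈ H_0^1(Θ) ∖ {0} : J_λ'(u)u = 0}`, with `J_λ'(u)u` the
derivative of `J_λ` at `u` in the direction `u`. -/
def nehari {n : ℕ} (Θ : Set (EuclideanSpace ℝ (Fin n))) (a b c : EuclideanSpace ℝ (Fin n) → ℝ)
    (lam : ℝ) : Set (H10 Θ) :=
  {u | u ≠ 0 ∧ HasLineDerivAt ℝ (J Θ a b c lam) 0 u u}

/-- `ℓ_λ = inf J_λ` over the Nehari manifold, as an extended real. -/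
def ell {n : ℕ} (Θ : Set (EuclideanSpace ℝ (Fin n))) (a b c : EuclideanSpace ℝ (Fin n) → ℝ)
    (lam : ℝ) : EReal :=
  ⨅ u ∈ nehari Θ a b c lam, (J Θ a b c lam u : EReal)

/-- The eigenvalues of `-div(a ∇u) = μ b u` in `Θ`, `u = 0` on `∂Θ` (weak formulation). -/
def eigenvalues {n : ℕ} (Θ : Set (EuclideanSpace ℝ (Fin n)))
    (a b : EuclideanSpace ℝ (Fin n) → ℝ) : Set ℝ :=
  {μ | ∃ u : H10 Θ, u ≠ 0 ∧ ∀ v : H10 Θ,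
    (∫ x in Θ, a x * ⟪gradH u x, gradH v x⟫_ℝ) = μ * ∫ x in Θ, b x * (valH u x * valH v x)}

/-- The first eigenvalue `λ_1^{a,b}`. -/
def firstEigenvalue {n : ℕ} (Θ : Set (EuclideanSpace ℝ (Fin n)))
    (a b : EuclideanSpace ℝ (Fin n) → ℝ) : ℝ :=
  sInf (eigenvalues Θ a b)

/-- `G` is the weak gradient of `u` on `ℝⁿ`. -/
def IsWeakGradient {n : ℕ} (u : EuclideanSpace ℝ (Fin n) → ℝ)
    (G : EuclideanSpace ℝ (Fin n) → EuclideanSpace ℝ (Fin n)) : Prop :=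
  ∀ φ : EuclideanSpace ℝ (Fin n) → ℝ, IsTestFunction univ φ →
    (∫ x, u x • gradient φ x) = -∫ x, φ x • G x

/-- The best Sobolev constant `S` of the embedding `H^1(ℝⁿ) ↪ L^{2^*}(ℝⁿ)`: the infimum of
`∫ |∇u|² / (∫ |u|^{2^*})^{2/2^*}` over `u ∈ H^1(ℝⁿ) ∖ {0}`. -/
def sobolevConst (n : ℕ) : ℝ :=
  sInf {q | ∃ (u : EuclideanSpace ℝ (Fin n) → ℝ)
    (G : EuclideanSpace ℝ (Fin n) → EuclideanSpace ℝ (Fin n)),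
    MemLp u 2 volume ∧ MemLp G 2 volume ∧ IsWeakGradient u G ∧ ¬ u =ᵐ[volume] 0 ∧
    q = (∫ x, ‖G x‖ ^ 2) / (∫ x, |u x| ^ critExp n) ^ (2 / critExp n)}

/-- `κ^{a,c} = (min_{closure Θ} a^{n/2} / c^{(n-2)/2}) · (1/n) · S^{n/2}`. -/
def kappa {n : ℕ} (Θ : Set (EuclideanSpace ℝ (Fin n)))
    (a c : EuclideanSpace ℝ (Fin n) → ℝ) : ℝ :=
  sInf ((fun x => a x ^ ((n : ℝ) / 2) / c x ^ (((n : ℝ) - 2) / 2)) '' closure Θ)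
    * (1 / n) * sobolevConst n ^ ((n : ℝ) / 2)

/-- `λ_{0,*}^{a,b,c} = inf {λ ∈ (-∞, λ_1^{a,b}) : ℓ_λ < κ^{a,c}}`, as an extended real. -/
def lambdaZeroStar {n : ℕ} (Θ : Set (EuclideanSpace ℝ (Fin n)))
    (a b c : EuclideanSpace ℝ (Fin n) → ℝ) : EReal :=
  sInf ((fun lam : ℝ => (lam : EReal)) ''
    {lam : ℝ | lam < firstEigenvalue Θ a b ∧ ell Θ a b c lam < (kappa Θ a c : EReal)})

/-- The weight `x ↦ x_1^k`. -/
def weight {n : ℕ} [NeZero n] (k : ℕ) (x : EuclideanSpace ℝ (Fin n)) : ℝ := x 0 ^ k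

/-- `λ_{0,*}^{[k]}`: the case `a = b = c = x_1^k`. -/
def lambdaZeroStarK {n : ℕ} [NeZero n] (Θ : Set (EuclideanSpace ℝ (Fin n))) (k : ℕ) : EReal :=
  lambdaZeroStar Θ (weight k) (weight k) (weight k)

end AnisoCrit

end

/-! Write `u = f v` with `f = f(x₁)`, put `g = t^k f'`, and let `m` be the minimum on the right-hand
side. Completing the square (`picone_identity`) splits `x₁^k |∇u|²` into `x₁^k f² |∇v|²`, the total
derivative `∂₁((g/f) u²)`, whose integral vanishes for `u ∈ H₀¹`, and a potential term `(-g'/(x₁^k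
f)) x₁^k u²`. The first condition on `f` and the definition of `m` then give `energy_lower_bound`:
with `A = ∫ x₁^k |∇u|²`, `B = ∫ x₁^k u²` and `X = ∫ |∇v|²`, one has `α^k f(α)² X + m B ≤ A`.

Let `u` be in the Nehari set with `λ < m`, and put `D = ∫ x₁^k |u|^{2*}`, `P = ∫ |v|^{2*}`. The
Nehari identity `A - λ B = D` yields `α^k f(α)² X ≤ D`; the second condition on `f` yields `D ≤ α^k
f(α)^{2*} P`; Sobolev's inequality for `v` extended by zero yields `S P^{2/2*} ≤ X`. The powers of
`f(α)` cancel, leaving `α^k S^{n/2} ≤ D` (`mul_rpow_le_of_sobolev_bounds`). Since `J = D/n` on the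
Nehari set, `ℓ_λ ≥ κ` whenever `λ < m`, so no such `λ` enters the infimum. -/

namespace AnisoCrit

/-! ### Weighted bilinear and linear forms on `L²`. -/

section Pairing

variable {X F G : Type*} [MeasurableSpace X] {μ : Measure X}
  [NormedAddCommGroup F] [NormedSpace ℝ F] [NormedAddCommGroup G] [NormedSpace ℝ G]

/-- A bounded weight times a bounded bilinear form is a continuous form on `L²`. -/
theorem continuous_integral_mul_bilin {a : X → ℝ} (ha : MemLp a ⊤ μ) (B : F →L[ℝ] G →L[ℝ] ℝ) :
    Continuous fun p : Lp F 2 μ × Lp G 2 μ => ∫ x, a x * B (p.1 x) (p.2 x) ∂μ := by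
  -- Multiplication by `a` is a bounded operator on `L²` by Hölder, so the form is the `L²` pairing
  -- precomposed with it.
  let T : Lp F 2 μ →L[ℝ] Lp F 2 μ := (ContinuousLinearMap.lsmul ℝ ℝ).holderL μ ⊤ 2 2 (ha.toLp a)
  have key : (fun p : Lp F 2 μ × Lp G 2 μ => ∫ x, a x * B (p.1 x) (p.2 x) ∂μ)
      = fun p => B.lpPairing μ 2 2 (T p.1) p.2 := by
    ext p
    rw [ContinuousLinearMap.lpPairing_eq_integral]
    apply integral_congr_ae
    have h1 : T p.1 =ᵐ[μ] fun x => (ha.toLp a) x • p.1 x :=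
      (ContinuousLinearMap.lsmul ℝ ℝ).coeFn_holder (r := 2) (ha.toLp a) p.1
    filter_upwards [h1, ha.coeFn_toLp] with x hx hx'
    rw [hx, hx']
    simp
  rw [key]
  fun_prop

theorem integrable_mul_bilin {a : X → ℝ} (ha : MemLp a ⊤ μ) (B : F →L[ℝ] G →L[ℝ] ℝ)
    {u : X → F} {v : X → G} (hu : MemLp u 2 μ) (hv : MemLp v 2 μ) :
    Integrable (fun x => a x * B (u x) (v x)) μ := by
  have h := B.memLp_of_bilin (r := 1) hu hv
  exact memLp_one_iff_integrable.1 (h.mul (p := ⊤) ha)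

/-- On a finite measure space the constant `1` is in `L²`, so this is the bilinear case with second
argument frozen at `1`. -/
theorem continuous_integral_mul_apply [IsFiniteMeasure μ] {a : X → ℝ} (ha : MemLp a ⊤ μ)
    (l : F →L[ℝ] ℝ) : Continuous fun p : Lp F 2 μ => ∫ x, a x * l (p x) ∂μ := by
  let B : F →L[ℝ] ℝ →L[ℝ] ℝ := (ContinuousLinearMap.lsmul ℝ ℝ).comp l
  let one : Lp ℝ 2 μ := (memLp_const (1 : ℝ)).toLp
  have h := (continuous_integral_mul_bilin ha B).comp
    (Continuous.prodMk continuous_id (continuous_const (y := one)))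
  convert h using 2 with p
  apply integral_congr_ae
  filter_upwards [(memLp_const (1 : ℝ)).coeFn_toLp (μ := μ) (p := 2)] with x hx
  have : one x = 1 := hx
  simp [B, this]

theorem integrable_mul_apply [IsFiniteMeasure μ] {a : X → ℝ} (ha : MemLp a ⊤ μ)
    (l : F →L[ℝ] ℝ) {u : X → F} (hu : MemLp u 2 μ) : Integrable (fun x => a x * l (u x)) μ := by
  have h : MemLp (fun x => l (u x)) 2 μ := l.comp_memLp' hu
  exact (h.mul (p := ⊤) (r := 2) ha).integrable (by norm_num)

end Pairing

/-! ### Integration by parts for elements of `H₀¹(Θ)`. -/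

variable {n : ℕ} {Θ : Set (EuclideanSpace ℝ (Fin n))}

theorem inner_gradient_eq_fderiv {φ : EuclideanSpace ℝ (Fin n) → ℝ}
    (x e : EuclideanSpace ℝ (Fin n)) : ⟪gradient φ x, e⟫_ℝ = fderiv ℝ φ x e := by
  simp [gradient]

/-- The integral of a derivative of a compactly supported `C¹` function vanishes. -/
theorem integral_fderiv_eq_zero {F : EuclideanSpace ℝ (Fin n) → ℝ} (hF : ContDiff ℝ 1 F)
    (hc : HasCompactSupport F) (e : EuclideanSpace ℝ (Fin n)) : ∫ x, fderiv ℝ F x e = 0 := by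
  have h := integral_mul_fderiv_eq_neg_fderiv_mul_of_integrable (μ := volume) (v := e)
    (f := fun _ : EuclideanSpace ℝ (Fin n) => (1 : ℝ)) (g := F) (by simp) ?_ ?_
    (fun x _ => by fun_prop) (fun x _ => (hF.differentiable (by norm_num)) x)
  · simpa using h
  · simp only [one_mul]
    refine Continuous.integrable_of_hasCompactSupport ?_ (hc.fderiv_apply (𝕜 := ℝ) e)
    exact (hF.continuous_fderiv (by norm_num)).clm_apply continuous_const
  · simpa using hF.continuous.integrable_of_hasCompactSupport hc

/-- Outside `Θ`, where nothing is known about `W`, the factor `ψ` vanishes in a whole neighbourhood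
of the point. -/
theorem contDiff_mul_of_tsupport_subset {W ψ : EuclideanSpace ℝ (Fin n) → ℝ} (hΘ : IsOpen Θ)
    (hW : ContDiffOn ℝ 1 W Θ) (hψ : ContDiff ℝ 1 ψ) (hs : tsupport ψ ⊆ Θ) :
    ContDiff ℝ 1 fun x => W x * ψ x := by
  rw [contDiff_iff_contDiffAt]
  intro x
  by_cases hx : x ∈ Θ
  · exact (hW.contDiffAt (hΘ.mem_nhds hx)).mul hψ.contDiffAt
  · have h0 : ψ =ᶠ[nhds x] 0 := notMem_tsupport_iff_eventuallyEq.1 fun h => hx (hs h)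
    refine (contDiffAt_const (c := (0 : ℝ))).congr_of_eventuallyEq ?_
    filter_upwards [h0] with y hy
    simp [hy]

/-- Integration by parts against a compactly supported factor. -/
theorem setIntegral_product_rule_eq_zero {W ψ : EuclideanSpace ℝ (Fin n) → ℝ} (hΘ : IsOpen Θ)
    (hW : ContDiffOn ℝ 1 W Θ) (hψ : ContDiff ℝ 1 ψ) (hc : HasCompactSupport ψ)
    (hs : tsupport ψ ⊆ Θ) (e : EuclideanSpace ℝ (Fin n)) :
    ∫ x in Θ, (W x * ⟪gradient ψ x, e⟫_ℝ + ψ x * ⟪gradient W x, e⟫_ℝ) = 0 := by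
  have hF := contDiff_mul_of_tsupport_subset hΘ hW hψ hs
  have hFc : HasCompactSupport fun x => W x * ψ x := hc.mul_left
  rw [← integral_fderiv_eq_zero hF hFc e, ← setIntegral_eq_integral_of_forall_compl_eq_zero
    (s := Θ) (f := fun x => fderiv ℝ (fun x => W x * ψ x) x e)]
  · refine setIntegral_congr_fun hΘ.measurableSet fun x hx => ?_
    have h1 := (hW.contDiffAt (hΘ.mem_nhds hx)).differentiableAt (by norm_num)
    have h2 := (hψ.differentiable (by norm_num)) x
    simp only [inner_gradient_eq_fderiv]
    rw [fderiv_fun_mul h1 h2]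
    simp
  · intro x hx
    have h0 : ψ =ᶠ[nhds x] 0 := notMem_tsupport_iff_eventuallyEq.1 fun h => hx (hs h)
    have h3 : (fun x => W x * ψ x) =ᶠ[nhds x] fun _ => (0 : ℝ) := by
      filter_upwards [h0] with y hy
      simp [hy]
    rw [h3.fderiv_eq]
    simp

/-- Density argument: `H₀¹` is by definition a closure, so integral identities that are continuous
in the pair `(u, ∇u)` need checking only on test functions. -/
theorem H10_induction {P : Lp ℝ 2 (volume.restrict Θ) ×
      Lp (EuclideanSpace ℝ (Fin n)) 2 (volume.restrict Θ) → Prop} (hP : IsClosed {p | P p})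
    (h : ∀ p φ, IsTestFunction Θ φ → p.1 =ᵐ[volume.restrict Θ] φ →
      p.2 =ᵐ[volume.restrict Θ] gradient φ → P p) (u : H10 Θ) : P u.1 := by
  have hu : u.1 ∈ closure (testPairs Θ : Set (Lp ℝ 2 (volume.restrict Θ) ×
      Lp (EuclideanSpace ℝ (Fin n)) 2 (volume.restrict Θ))) := u.2
  refine closure_minimal ?_ hP hu
  rintro p ⟨φ, hφ, h1, h2⟩
  exact h p φ hφ h1 h2

theorem memLp_valH (u : H10 Θ) : MemLp (valH u) 2 (volume.restrict Θ) := Lp.memLp _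

theorem memLp_gradH (u : H10 Θ) : MemLp (gradH u) 2 (volume.restrict Θ) := Lp.memLp _

/-- `r, y ↦ r ⟪y, e⟫`. -/
noncomputable def mulInner (e : EuclideanSpace ℝ (Fin n)) :
    ℝ →L[ℝ] EuclideanSpace ℝ (Fin n) →L[ℝ] ℝ :=
  (ContinuousLinearMap.lsmul ℝ ℝ).flip (innerSL ℝ e)

theorem mulInner_apply (e y : EuclideanSpace ℝ (Fin n)) (r : ℝ) :
    mulInner e r y = r * ⟪y, e⟫_ℝ := by
  simp [mulInner, real_inner_comm]

/-- `∫ ∂ₑ(W u²) = 0` for `u ∈ H₀¹(Θ)`. -/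
theorem integral_deriv_mul_sq_eq_zero (hΘ : IsOpen Θ) {W : EuclideanSpace ℝ (Fin n) → ℝ}
    (hW : ContDiffOn ℝ 1 W Θ) (hWb : MemLp W ⊤ (volume.restrict Θ))
    (e : EuclideanSpace ℝ (Fin n))
    (hWb' : MemLp (fun x => ⟪gradient W x, e⟫_ℝ) ⊤ (volume.restrict Θ)) (u : H10 Θ) :
    2 * (∫ x in Θ, W x * (valH u x * ⟪gradH u x, e⟫_ℝ))
      + ∫ x in Θ, ⟪gradient W x, e⟫_ℝ * (valH u x * valH u x) = 0 := by
  have h1 := continuous_integral_mul_bilin hWb (mulInner e)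
  have h2 := (continuous_integral_mul_bilin hWb' (ContinuousLinearMap.mul ℝ ℝ)).comp
    (Continuous.prodMk continuous_fst (continuous_fst (X := Lp ℝ 2 (volume.restrict Θ))
      (Y := Lp (EuclideanSpace ℝ (Fin n)) 2 (volume.restrict Θ))))
  simp only [mulInner_apply] at h1
  simp only [Function.comp_def, ContinuousLinearMap.mul_apply'] at h2
  refine H10_induction (P := fun p =>
    2 * (∫ x in Θ, W x * (p.1 x * ⟪p.2 x, e⟫_ℝ))
      + ∫ x in Θ, ⟪gradient W x, e⟫_ℝ * (p.1 x * p.1 x) = 0)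
    (isClosed_eq ((h1.const_mul 2).add h2) continuous_const) ?_ u
  intro p φ hφ hp1 hp2
  have hφ1 : ContDiff ℝ 1 φ := hφ.contDiff.of_le (by simp)
  have hsq := setIntegral_product_rule_eq_zero hΘ hW (hφ1.mul hφ1) hφ.hasCompactSupport.mul_left
    ((tsupport_mul_subset_left).trans hφ.tsupport_subset) e
  rw [← hsq, ← integral_const_mul, ← integral_add]
  · apply integral_congr_ae
    filter_upwards [hp1, hp2] with x hx1 hx2
    have hd := (hφ1.differentiable (by norm_num)) x
    rw [hx1, hx2]
    simp only [inner_gradient_eq_fderiv]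
    rw [fderiv_fun_mul hd hd]
    simp
    ring
  · have := integrable_mul_bilin hWb (mulInner e) (Lp.memLp p.1) (Lp.memLp p.2)
    simp only [mulInner_apply] at this
    exact this.const_mul 2
  · exact integrable_mul_bilin hWb' (ContinuousLinearMap.mul ℝ ℝ) (Lp.memLp p.1) (Lp.memLp p.1)

/-- `∫_Θ (W u ⟪∇φ, e⟫ + φ W ⟪∇u, e⟫ + φ u ⟪∇W, e⟫) = 0` for `u ∈ H₀¹(Θ)`. -/
theorem integral_product_test_eq_zero [IsFiniteMeasure (volume.restrict Θ)] (hΘ : IsOpen Θ)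
    {W φ : EuclideanSpace ℝ (Fin n) → ℝ}
    (hW : ContDiffOn ℝ 1 W Θ) (hWb : MemLp W ⊤ (volume.restrict Θ))
    (e : EuclideanSpace ℝ (Fin n))
    (hWb' : MemLp (fun x => ⟪gradient W x, e⟫_ℝ) ⊤ (volume.restrict Θ))
    (hφ : ContDiff ℝ 1 φ) (hφc : HasCompactSupport φ) (u : H10 Θ) :
    (∫ x in Θ, (W x * ⟪gradient φ x, e⟫_ℝ + φ x * ⟪gradient W x, e⟫_ℝ) * valH u x)
      + ∫ x in Θ, (φ x * W x) * ⟪gradH u x, e⟫_ℝ = 0 := by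
  have hφb : MemLp φ ⊤ (volume.restrict Θ) := by
    obtain ⟨C, hC⟩ := hφc.exists_bound_of_continuous hφ.continuous
    exact memLp_top_of_bound hφ.continuous.aestronglyMeasurable C (Filter.Eventually.of_forall hC)
  have hφb' : MemLp (fun x => ⟪gradient φ x, e⟫_ℝ) ⊤ (volume.restrict Θ) := by
    simp only [inner_gradient_eq_fderiv]
    have hcont : Continuous fun x => fderiv ℝ φ x e :=
      (hφ.continuous_fderiv (by norm_num)).clm_apply continuous_const
    obtain ⟨C, hC⟩ := (hφc.fderiv_apply (𝕜 := ℝ) e).exists_bound_of_continuous hcont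
    exact memLp_top_of_bound hcont.aestronglyMeasurable C (Filter.Eventually.of_forall hC)
  have ha : MemLp (fun x => W x * ⟪gradient φ x, e⟫_ℝ + φ x * ⟪gradient W x, e⟫_ℝ) ⊤
      (volume.restrict Θ) := (hφb'.mul hWb).add (hWb'.mul hφb)
  have hb : MemLp (fun x => φ x * W x) ⊤ (volume.restrict Θ) := hWb.mul hφb
  let l : EuclideanSpace ℝ (Fin n) →L[ℝ] ℝ := innerSL ℝ e
  have hl : ∀ y, l y = ⟪y, e⟫_ℝ := fun y => by simp [l, real_inner_comm]
  have h1 := (continuous_integral_mul_apply ha (ContinuousLinearMap.id ℝ ℝ)).comp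
    (continuous_fst (X := Lp ℝ 2 (volume.restrict Θ))
      (Y := Lp (EuclideanSpace ℝ (Fin n)) 2 (volume.restrict Θ)))
  have h2 := (continuous_integral_mul_apply hb l).comp
    (continuous_snd (X := Lp ℝ 2 (volume.restrict Θ))
      (Y := Lp (EuclideanSpace ℝ (Fin n)) 2 (volume.restrict Θ)))
  simp only [Function.comp_def, ContinuousLinearMap.id_apply, hl] at h1 h2
  refine H10_induction (P := fun p =>
    (∫ x in Θ, (W x * ⟪gradient φ x, e⟫_ℝ + φ x * ⟪gradient W x, e⟫_ℝ) * p.1 x)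
      + ∫ x in Θ, (φ x * W x) * ⟪p.2 x, e⟫_ℝ = 0)
    (isClosed_eq (h1.add h2) continuous_const) ?_ u
  intro p ψ hψ hp1 hp2
  have hψ1 : ContDiff ℝ 1 ψ := hψ.contDiff.of_le (by simp)
  -- The support inside `Θ` comes from `ψ`, which approximates `u`; `φ` need not vanish near `∂Θ`
  -- and is absorbed into the `C¹` coefficient.
  have hsq := setIntegral_product_rule_eq_zero hΘ (hW.mul hφ.contDiffOn) hψ1 hψ.hasCompactSupport
    hψ.tsupport_subset e
  rw [← hsq, ← integral_add]
  · apply integral_congr_ae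
    filter_upwards [hp1, hp2, ae_restrict_mem hΘ.measurableSet] with x hx1 hx2 hx
    have hd := (hφ.differentiable (by norm_num)) x
    have hd' := (hW.contDiffAt (hΘ.mem_nhds hx)).differentiableAt (by norm_num)
    rw [hx1, hx2]
    simp only [inner_gradient_eq_fderiv]
    rw [fderiv_fun_mul hd' hd]
    simp
    ring
  · exact integrable_mul_apply ha (ContinuousLinearMap.id ℝ ℝ) (Lp.memLp p.1)
  · have := integrable_mul_apply hb l (Lp.memLp p.2)
    simpa only [hl] using this

/-! ### Extension by zero and the Sobolev quotient. -/

/-- Extending `W u` by zero outside `Θ` gives a function with weak gradient on the whole space. -/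
theorem isWeakGradient_indicator_mul [IsFiniteMeasure (volume.restrict Θ)] (hΘ : IsOpen Θ)
    {W : EuclideanSpace ℝ (Fin n) → ℝ}
    (hW : ContDiffOn ℝ 1 W Θ) (hWb : MemLp W ⊤ (volume.restrict Θ))
    (hWb' : MemLp (gradient W) ⊤ (volume.restrict Θ)) (u : H10 Θ) :
    IsWeakGradient (Θ.indicator fun x => W x * valH u x)
      (Θ.indicator fun x => W x • gradH u x + valH u x • gradient W x) := by
  intro φ hφ
  have hφ1 : ContDiff ℝ 1 φ := hφ.contDiff.of_le (by simp)
  have hφb : MemLp φ ⊤ (volume.restrict Θ) := by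
    obtain ⟨C, hC⟩ := hφ.hasCompactSupport.exists_bound_of_continuous hφ1.continuous
    exact memLp_top_of_bound hφ1.continuous.aestronglyMeasurable C
      (Filter.Eventually.of_forall hC)
  have hφb' : MemLp (gradient φ) ⊤ (volume.restrict Θ) := by
    have hcont : Continuous (gradient φ) := by
      unfold gradient
      exact (LinearIsometryEquiv.continuous _).comp (hφ1.continuous_fderiv (by norm_num))
    have hc : HasCompactSupport (gradient φ) := by
      refine (hφ.hasCompactSupport.fderiv (𝕜 := ℝ)).comp_left
        (g := (InnerProductSpace.toDual ℝ (EuclideanSpace ℝ (Fin n))).symm) ?_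
      simp
    obtain ⟨C, hC⟩ := hc.exists_bound_of_continuous hcont
    exact memLp_top_of_bound hcont.aestronglyMeasurable C (Filter.Eventually.of_forall hC)
  have e1 : (∫ x, (Θ.indicator fun x => W x * valH u x) x • gradient φ x)
      = ∫ x in Θ, (W x * valH u x) • gradient φ x := by
    rw [← integral_indicator hΘ.measurableSet]
    congr 1; ext1 x
    by_cases hx : x ∈ Θ <;> simp [hx]
  have e2 : (∫ x, φ x • (Θ.indicator fun x => W x • gradH u x + valH u x • gradient W x) x)
      = ∫ x in Θ, φ x • (W x • gradH u x + valH u x • gradient W x) := by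
    rw [← integral_indicator hΘ.measurableSet]
    congr 1; ext1 x
    by_cases hx : x ∈ Θ <;> simp [hx]
  have hv : MemLp (fun x => W x * valH u x) 2 (volume.restrict Θ) := (memLp_valH u).mul hWb
  have i1 : Integrable (fun x => (W x * valH u x) • gradient φ x) (volume.restrict Θ) :=
    (hφb'.smul (r := 2) hv).integrable (by norm_num)
  have hG : MemLp (fun x => W x • gradH u x + valH u x • gradient W x) 2 (volume.restrict Θ) :=
    ((memLp_gradH u).smul hWb).add (hWb'.smul (memLp_valH u))
  have i2 : Integrable (fun x => φ x • (W x • gradH u x + valH u x • gradient W x))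
      (volume.restrict Θ) := (hG.smul (r := 2) hφb).integrable (by norm_num)
  rw [e1, e2, ← add_eq_zero_iff_eq_neg, ← integral_add i1 i2]
  -- The vector identity is tested against each direction `e`, which reduces it to the scalar
  -- `integral_product_test_eq_zero`.
  refine ext_inner_left ℝ fun e => ?_
  have hi := integral_inner (𝕜 := ℝ) (i1.add i2) e
  simp only [Pi.add_apply] at hi
  rw [← hi, inner_zero_right]
  have hWe : MemLp (fun x => ⟪gradient W x, e⟫_ℝ) ⊤ (volume.restrict Θ) := by
    have := (innerSL ℝ e).comp_memLp' hWb'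
    simpa [Function.comp_def, real_inner_comm] using this
  have hφe : MemLp (fun x => ⟪gradient φ x, e⟫_ℝ) ⊤ (volume.restrict Θ) := by
    have := (innerSL ℝ e).comp_memLp' hφb'
    simpa [Function.comp_def, real_inner_comm] using this
  have hge : MemLp (fun x => ⟪gradH u x, e⟫_ℝ) 2 (volume.restrict Θ) := by
    have := (innerSL ℝ e).comp_memLp' (memLp_gradH u)
    simpa [Function.comp_def, real_inner_comm] using this
  have ha : MemLp (fun x => W x * ⟪gradient φ x, e⟫_ℝ + φ x * ⟪gradient W x, e⟫_ℝ) ⊤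
      (volume.restrict Θ) := (hφe.mul hWb).add (hWe.mul hφb)
  have hb : MemLp (fun x => φ x * W x) ⊤ (volume.restrict Θ) := hWb.mul hφb
  have h := integral_product_test_eq_zero hΘ hW hWb e hWe hφ1 hφ.hasCompactSupport u
  rw [← integral_add] at h
  · rw [← h]
    congr 1; ext1 x
    simp only [inner_add_right, real_inner_smul_right, real_inner_comm e]
    ring
  · exact ((memLp_valH u).mul (r := 2) ha).integrable (by norm_num)
  · exact (hge.mul (r := 2) hb).integrable (by norm_num)

/-- The Sobolev quotient of `W u`, extended by zero, bounds the Sobolev constant from above. -/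
theorem sobolevConst_le_quotient [IsFiniteMeasure (volume.restrict Θ)] (hΘ : IsOpen Θ)
    (hexp : critExp n ≠ 0)
    {W : EuclideanSpace ℝ (Fin n) → ℝ}
    (hW : ContDiffOn ℝ 1 W Θ) (hWb : MemLp W ⊤ (volume.restrict Θ))
    (hWb' : MemLp (gradient W) ⊤ (volume.restrict Θ)) (u : H10 Θ)
    (hne : ¬ (fun x => W x * valH u x) =ᵐ[volume.restrict Θ] 0) :
    sobolevConst n ≤ (∫ x in Θ, ‖W x • gradH u x + valH u x • gradient W x‖ ^ 2)
      / (∫ x in Θ, |W x * valH u x| ^ critExp n) ^ (2 / critExp n) := by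
  refine csInf_le ⟨0, ?_⟩ ?_
  · rintro q ⟨v, G, -, -, -, -, rfl⟩
    have h1 : 0 ≤ ∫ x, ‖G x‖ ^ 2 := integral_nonneg fun x => by positivity
    have h2 : 0 ≤ ∫ x, |v x| ^ critExp n := integral_nonneg fun x => by positivity
    positivity
  · refine ⟨_, _, ?_, ?_, isWeakGradient_indicator_mul hΘ hW hWb hWb' u, ?_, ?_⟩
    · rw [memLp_indicator_iff_restrict hΘ.measurableSet]
      exact (memLp_valH u).mul hWb
    · rw [memLp_indicator_iff_restrict hΘ.measurableSet]
      exact ((memLp_gradH u).smul hWb).add (hWb'.smul (memLp_valH u))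
    · exact fun h => hne ((indicator_ae_eq_restrict hΘ.measurableSet).symm.trans
        (ae_restrict_of_ae h))
    · congr 1
      · rw [← integral_indicator hΘ.measurableSet]
        congr 1; ext1 x
        by_cases hx : x ∈ Θ <;> simp [hx]
      · rw [← integral_indicator hΘ.measurableSet]
        congr 2; ext1 x
        by_cases hx : x ∈ Θ <;> simp [hx, Real.zero_rpow hexp]

/-! ### The critical exponent and the Nehari identity. -/

theorem two_lt_critExp {n : ℕ} (hn : 3 ≤ n) : 2 < critExp n := by
  have : (3 : ℝ) ≤ n := by exact_mod_cast hn
  rw [critExp, lt_div_iff₀ (by linarith)]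
  linarith

theorem one_div_critExp {n : ℕ} (hn : 3 ≤ n) : 1 / critExp n = 1 / 2 - 1 / n := by
  have : (3 : ℝ) ≤ n := by exact_mod_cast hn
  have h2 : (n : ℝ) - 2 ≠ 0 := by linarith
  rw [critExp]
  field_simp

section Nehari

variable {n : ℕ} {Θ : Set (EuclideanSpace ℝ (Fin n))}

theorem valH_add_smul (u : H10 Θ) (t : ℝ) :
    valH (u + t • u) =ᵐ[volume.restrict Θ] fun x => (1 + t) * valH u x := by
  have h1 := Lp.coeFn_add u.1.1 (t • u.1.1)
  have h2 := Lp.coeFn_smul t u.1.1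
  filter_upwards [h1, h2] with x h1 h2
  have h3 : valH (u + t • u) x = (u.1.1 + t • u.1.1) x := rfl
  rw [h3, h1, Pi.add_apply, h2]
  simp only [Pi.smul_apply, smul_eq_mul, valH]
  ring

theorem gradH_add_smul (u : H10 Θ) (t : ℝ) :
    gradH (u + t • u) =ᵐ[volume.restrict Θ] fun x => (1 + t) • gradH u x := by
  have h1 := Lp.coeFn_add u.1.2 (t • u.1.2)
  have h2 := Lp.coeFn_smul t u.1.2
  filter_upwards [h1, h2] with x h1 h2
  have h3 : gradH (u + t • u) x = (u.1.2 + t • u.1.2) x := rfl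
  rw [h3, h1, Pi.add_apply, h2]
  simp only [Pi.smul_apply, gradH, add_smul, one_smul]

/-- By homogeneity, `J` along the ray through `u` is an explicit function of `t`, so the Nehari
condition becomes one-variable calculus. -/
theorem J_add_smul (a b c : EuclideanSpace ℝ (Fin n) → ℝ) (lam : ℝ) (u : H10 Θ) (t : ℝ) :
    J Θ a b c lam (u + t • u) =
      1 / 2 * ((1 + t) ^ 2 * ∫ x in Θ, a x * ‖gradH u x‖ ^ 2)
        - lam / 2 * ((1 + t) ^ 2 * ∫ x in Θ, b x * valH u x ^ 2)
        - 1 / critExp n * (|1 + t| ^ critExp n * ∫ x in Θ, c x * |valH u x| ^ critExp n) := by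
  have hA : ∫ x in Θ, a x * ‖gradH (u + t • u) x‖ ^ 2
      = (1 + t) ^ 2 * ∫ x in Θ, a x * ‖gradH u x‖ ^ 2 := by
    rw [← integral_const_mul]
    apply integral_congr_ae
    filter_upwards [gradH_add_smul u t] with x hx
    rw [hx, norm_smul, mul_pow, Real.norm_eq_abs, sq_abs]
    ring
  have hB : ∫ x in Θ, b x * valH (u + t • u) x ^ 2
      = (1 + t) ^ 2 * ∫ x in Θ, b x * valH u x ^ 2 := by
    rw [← integral_const_mul]
    apply integral_congr_ae
    filter_upwards [valH_add_smul u t] with x hx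
    rw [hx]
    ring
  have hD : ∫ x in Θ, c x * |valH (u + t • u) x| ^ critExp n
      = |1 + t| ^ critExp n * ∫ x in Θ, c x * |valH u x| ^ critExp n := by
    rw [← integral_const_mul]
    apply integral_congr_ae
    filter_upwards [valH_add_smul u t] with x hx
    rw [hx, abs_mul, Real.mul_rpow (abs_nonneg _) (abs_nonneg _)]
    ring
  rw [J, hA, hB, hD]

/-- On the Nehari manifold the quadratic part equals the critical part. -/
theorem nehari_identity {a b c : EuclideanSpace ℝ (Fin n) → ℝ} {lam : ℝ} {u : H10 Θ}
    (hp : critExp n ≠ 0) (hu : u ∈ nehari Θ a b c lam) :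
    (∫ x in Θ, a x * ‖gradH u x‖ ^ 2) - lam * (∫ x in Θ, b x * valH u x ^ 2)
      = ∫ x in Θ, c x * |valH u x| ^ critExp n := by
  set A := ∫ x in Θ, a x * ‖gradH u x‖ ^ 2 with hA
  set B := ∫ x in Θ, b x * valH u x ^ 2 with hB
  set D := ∫ x in Θ, c x * |valH u x| ^ critExp n with hD
  have h0 : HasDerivAt (fun t : ℝ => J Θ a b c lam (u + t • u)) 0 0 := hu.2
  simp only [J_add_smul, ← hA, ← hB, ← hD] at h0
  have h1 : HasDerivAt (fun t : ℝ => 1 + t) 1 0 := (hasDerivAt_id (0 : ℝ)).const_add 1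
  have h2 : HasDerivAt (fun t : ℝ => (1 + t) ^ critExp n) (critExp n) 0 := by
    simpa using h1.rpow_const (p := critExp n) (Or.inl (by norm_num))
  -- The absolute value is harmless because `1 + t > 0` near `t = 0`.
  have h3 : HasDerivAt (fun t : ℝ => |1 + t| ^ critExp n) (critExp n) 0 := by
    refine h2.congr_of_eventuallyEq ?_
    filter_upwards [lt_mem_nhds (show (-1 : ℝ) < 0 by norm_num)] with t ht
    rw [abs_of_pos (by linarith)]
  have h4 : HasDerivAt (fun t : ℝ => (1 + t) ^ 2) 2 0 := by
    simpa using h1.fun_pow 2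
  have h5 := (((h4.mul_const A).const_mul (1 / 2)).sub ((h4.mul_const B).const_mul (lam / 2))).sub
    ((h3.mul_const D).const_mul (1 / critExp n))
  have h6 := h0.unique h5
  have h7 : 1 / critExp n * (critExp n * D) = D := by field_simp
  rw [h7] at h6
  linarith

theorem J_eq_of_mem_nehari {a b c : EuclideanSpace ℝ (Fin n) → ℝ} {lam : ℝ} {u : H10 Θ}
    (hn : 3 ≤ n) (hu : u ∈ nehari Θ a b c lam) :
    J Θ a b c lam u = 1 / n * ∫ x in Θ, c x * |valH u x| ^ critExp n := by
  have hp : critExp n ≠ 0 := by linarith [two_lt_critExp hn]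
  have h := nehari_identity hp hu
  rw [J, one_div_critExp hn, ← h]
  ring

end Nehari

/-! ### Functions of the first coordinate on a strip. -/

section Strip

variable {n : ℕ} [NeZero n] {Θ : Set (EuclideanSpace ℝ (Fin n))} {α β : ℝ}

/-- The coordinate map is open, so the image of `Θ` lies in the interior of the interval. There the
one-sided `derivWithin` on `Icc α β` is a genuine derivative. -/
theorem coord_mem_Ioo (hΘ : IsOpen Θ) (h : ∀ x ∈ Θ, x 0 ∈ Icc α β) :
    ∀ x ∈ Θ, x 0 ∈ Ioo α β := by
  have hopen : IsOpenMap fun x : EuclideanSpace ℝ (Fin n) => x 0 := by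
    refine (EuclideanSpace.proj 0 : EuclideanSpace ℝ (Fin n) →L[ℝ] ℝ).isOpenMap ?_
    intro r
    exact ⟨EuclideanSpace.single 0 r, by simp⟩
  intro x hx
  have hsub : (fun x : EuclideanSpace ℝ (Fin n) => x 0) '' Θ ⊆ Icc α β := by
    rintro _ ⟨y, hy, rfl⟩
    exact h y hy
  have := interior_maximal hsub (hopen _ hΘ)
  rw [interior_Icc] at this
  exact this ⟨x, hx, rfl⟩

theorem hasGradientAt_comp_coord {h : ℝ → ℝ} (hh : ContDiffOn ℝ 1 h (Icc α β))
    {x : EuclideanSpace ℝ (Fin n)} (hx : x 0 ∈ Ioo α β) :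
    HasGradientAt (fun y : EuclideanSpace ℝ (Fin n) => h (y 0))
      (derivWithin h (Icc α β) (x 0) • EuclideanSpace.single 0 (1 : ℝ)) x := by
  have hnhds : Icc α β ∈ nhds (x 0) := Icc_mem_nhds hx.1 hx.2
  have hd : HasDerivAt h (derivWithin h (Icc α β) (x 0)) (x 0) :=
    ((hh.differentiableOn (by norm_num)) _
      (Ioo_subset_Icc_self hx)).hasDerivWithinAt.hasDerivAt hnhds
  have hp : HasFDerivAt (fun y : EuclideanSpace ℝ (Fin n) => y 0)
      (EuclideanSpace.proj 0 : EuclideanSpace ℝ (Fin n) →L[ℝ] ℝ) x :=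
    (EuclideanSpace.proj 0 : EuclideanSpace ℝ (Fin n) →L[ℝ] ℝ).hasFDerivAt
  have hdual : InnerProductSpace.toDual ℝ (EuclideanSpace ℝ (Fin n))
      (derivWithin h (Icc α β) (x 0) • EuclideanSpace.single 0 (1 : ℝ))
      = derivWithin h (Icc α β) (x 0) •
        (EuclideanSpace.proj 0 : EuclideanSpace ℝ (Fin n) →L[ℝ] ℝ) := by
    ext y
    simp [EuclideanSpace.inner_single_left]
  rw [hasGradientAt_iff_hasFDerivAt, hdual]
  exact hd.comp_hasFDerivAt x hp

theorem contDiffOn_comp_coord {h : ℝ → ℝ} (hh : ContDiffOn ℝ 1 h (Icc α β))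
    (hs : ∀ x ∈ Θ, x 0 ∈ Icc α β) :
    ContDiffOn ℝ 1 (fun y : EuclideanSpace ℝ (Fin n) => h (y 0)) Θ :=
  hh.comp (EuclideanSpace.proj 0 : EuclideanSpace ℝ (Fin n) →L[ℝ] ℝ).contDiff.contDiffOn hs

theorem memLp_top_comp_coord {g : ℝ → ℝ} (hΘ : IsOpen Θ) (hg : ContinuousOn g (Icc α β))
    (hs : ∀ x ∈ Θ, x 0 ∈ Icc α β) :
    MemLp (fun x : EuclideanSpace ℝ (Fin n) => g (x 0)) ⊤ (volume.restrict Θ) := by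
  obtain ⟨C, hC⟩ := isCompact_Icc.exists_bound_of_continuousOn hg
  refine memLp_top_of_bound ?_ C ?_
  · refine ContinuousOn.aestronglyMeasurable ?_ hΘ.measurableSet
    exact hg.comp (by fun_prop) hs
  · filter_upwards [ae_restrict_mem hΘ.measurableSet] with x hx using hC _ (hs x hx)

theorem memLp_top_gradient_comp_coord {h : ℝ → ℝ} (hΘ : IsOpen Θ) (hαβ : α < β)
    (hh : ContDiffOn ℝ 1 h (Icc α β)) (hs : ∀ x ∈ Θ, x 0 ∈ Ioo α β) :
    MemLp (gradient fun x : EuclideanSpace ℝ (Fin n) => h (x 0)) ⊤ (volume.restrict Θ) := by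
  have h1 := memLp_top_comp_coord (Θ := Θ) hΘ
    (hh.continuousOn_derivWithin (uniqueDiffOn_Icc hαβ) le_rfl)
    (fun x hx => Ioo_subset_Icc_self (hs x hx))
  have h2 := ((ContinuousLinearMap.id ℝ ℝ).smulRight
    (EuclideanSpace.single (0 : Fin n) (1 : ℝ))).comp_memLp' h1
  refine h2.ae_eq ?_
  filter_upwards [ae_restrict_mem hΘ.measurableSet] with x hx
  rw [(hasGradientAt_comp_coord hh (hs x hx)).gradient]
  simp

end Strip

/-! ### Pointwise identity and the algebra of exponents. -/

/-- The pointwise completion of the square behind the substitution `u = f v`. -/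
theorem picone_identity {E : Type*} [NormedAddCommGroup E] [InnerProductSpace ℝ E] (G e : E)
    (he : ‖e‖ = 1) (u a F F' g' : ℝ) (ha : a ≠ 0) (hF : F ≠ 0) :
    a * ‖G‖ ^ 2 = a * F ^ 2 * ‖F⁻¹ • G + u • ((-F' / F ^ 2) • e)‖ ^ 2
      + 2 * (a * F' / F * (u * ⟪G, e⟫_ℝ)) + (g' * F - a * F' * F') / F ^ 2 * (u * u)
      + -g' / (a * F) * (a * u ^ 2) := by
  rw [norm_add_sq_real, smul_smul, norm_smul, norm_smul, real_inner_smul_left,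
    real_inner_smul_right, he]
  simp only [mul_pow, Real.norm_eq_abs, sq_abs]
  field_simp
  ring

/-- From the three bounds on the transformed function to the lower bound on the energy. -/
theorem mul_rpow_le_of_sobolev_bounds {n p a F S X P D : ℝ} (hn : 0 < n) (hp : 0 < p)
    (hnp : 2 / p + 2 / n = 1) (ha : 0 < a) (hF : 0 < F) (hS : 0 ≤ S) (hP : 0 ≤ P) (hD : 0 < D)
    (h1 : a * F ^ 2 * X ≤ D) (h2 : S * P ^ (2 / p) ≤ X) (h3 : D ≤ a * F ^ p * P) :
    a * S ^ (n / 2) ≤ D := by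
  have hq : 0 ≤ 2 / p := by positivity
  have h4 : D ^ (2 / p) ≤ a ^ (2 / p) * F ^ 2 * P ^ (2 / p) := by
    have h5 := Real.rpow_le_rpow hD.le h3 hq
    rwa [Real.mul_rpow (by positivity) hP, Real.mul_rpow ha.le (by positivity),
      ← Real.rpow_mul hF.le, mul_div_cancel₀ _ hp.ne', Real.rpow_two] at h5
  have hsplit : ∀ {y : ℝ}, 0 < y → y = y ^ (2 / p) * y ^ (2 / n) := fun hy => by
    rw [← Real.rpow_add hy, hnp, Real.rpow_one]
  -- Since `2/p + 2/n = 1`, both `a` and `D` split as products of these two powers; cancelling `D ^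
  -- (2 / p)` and raising to the power `n / 2` finishes.
  have h6 : S * a ^ (2 / n) * D ^ (2 / p) ≤ D ^ (2 / n) * D ^ (2 / p) := by
    calc S * a ^ (2 / n) * D ^ (2 / p)
        ≤ S * a ^ (2 / n) * (a ^ (2 / p) * F ^ 2 * P ^ (2 / p)) := by gcongr
      _ = (a ^ (2 / p) * a ^ (2 / n)) * F ^ 2 * (S * P ^ (2 / p)) := by ring
      _ = a * F ^ 2 * (S * P ^ (2 / p)) := by rw [← hsplit ha]
      _ ≤ a * F ^ 2 * X := by gcongr
      _ ≤ D := h1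
      _ = D ^ (2 / n) * D ^ (2 / p) := by rw [mul_comm, ← hsplit hD]
  have h7 : S * a ^ (2 / n) ≤ D ^ (2 / n) := le_of_mul_le_mul_right h6 (by positivity)
  have h8 := Real.rpow_le_rpow (by positivity) h7 (show 0 ≤ n / 2 by positivity)
  have h9 : 2 / n * (n / 2) = 1 := by field_simp
  rw [Real.mul_rpow hS (by positivity), ← Real.rpow_mul ha.le, ← Real.rpow_mul hD.le, h9,
    Real.rpow_one, Real.rpow_one] at h8
  linarith

theorem sobolevConst_nonneg (n : ℕ) : 0 ≤ sobolevConst n := by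
  refine Real.sInf_nonneg ?_
  rintro q ⟨v, G, -, -, -, -, rfl⟩
  have h1 : 0 ≤ ∫ x, ‖G x‖ ^ 2 := integral_nonneg fun x => by positivity
  have h2 : 0 ≤ ∫ x, |v x| ^ critExp n := integral_nonneg fun x => by positivity
  positivity

/-! ### The energy bound and the Sobolev level. -/

section Main

variable {n k : ℕ} [NeZero n] {Θ : Set (EuclideanSpace ℝ (Fin n))} {α β : ℝ}

/-- With equal weights the exponents differ by `n/2 - (n-2)/2 = 1`, so the quotient in `kappa` is
the weight itself. It is applied at a point where `x 0 = α`. -/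
theorem kappa_weight_le (hpos : ∀ x ∈ closure Θ, 0 < x 0) {x : EuclideanSpace ℝ (Fin n)}
    (hx : x ∈ closure Θ) :
    kappa Θ (weight k) (weight k)
      ≤ 1 / n * (x 0 ^ k * sobolevConst n ^ ((n : ℝ) / 2)) := by
  have hval : ∀ y ∈ closure Θ,
      weight k y ^ ((n : ℝ) / 2) / weight k y ^ (((n : ℝ) - 2) / 2) = y 0 ^ k := by
    intro y hy
    have hw : 0 < weight k y := pow_pos (hpos y hy) k
    rw [← Real.rpow_sub hw, show (n : ℝ) / 2 - ((n : ℝ) - 2) / 2 = 1 by ring, Real.rpow_one]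
    rfl
  have hle : sInf ((fun y => weight k y ^ ((n : ℝ) / 2) / weight k y ^ (((n : ℝ) - 2) / 2)) ''
      closure Θ) ≤ x 0 ^ k := by
    refine csInf_le ⟨0, ?_⟩ ⟨x, hx, hval x hx⟩
    rintro _ ⟨y, hy, rfl⟩
    simp only [hval y hy]
    exact (pow_pos (hpos y hy) k).le
  have hS : 0 ≤ sobolevConst n ^ ((n : ℝ) / 2) := Real.rpow_nonneg (sobolevConst_nonneg n) _
  rw [kappa]
  calc _ ≤ x 0 ^ k * (1 / (n : ℝ)) * sobolevConst n ^ ((n : ℝ) / 2) := by gcongr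
    _ = _ := by ring

variable {f : ℝ → ℝ} {m : ℝ}

theorem contDiffOn_pow_mul_derivWithin (hαβ : α < β) (hf : ContDiffOn ℝ 2 f (Icc α β)) :
    ContDiffOn ℝ 1 (fun s => s ^ k * derivWithin f (Icc α β) s) (Icc α β) :=
  (contDiff_id.pow k).contDiffOn.mul (hf.derivWithin (uniqueDiffOn_Icc hαβ) (by norm_num))

theorem integrable_weight_mul_sq (hΘ : IsOpen Θ) (hs : ∀ x ∈ Θ, x 0 ∈ Icc α β) (u : H10 Θ) :
    Integrable (fun x => weight k x * valH u x ^ 2) (volume.restrict Θ) := by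
  have hw := memLp_top_comp_coord (Θ := Θ) hΘ (continuous_pow k).continuousOn hs
  simpa [weight, sq] using integrable_mul_bilin hw (ContinuousLinearMap.mul ℝ ℝ) (memLp_valH u)
    (memLp_valH u)

theorem integrable_weight_mul_norm_sq (hΘ : IsOpen Θ) (hs : ∀ x ∈ Θ, x 0 ∈ Icc α β)
    (u : H10 Θ) :
    Integrable (fun x => weight k x * ‖gradH u x‖ ^ 2) (volume.restrict Θ) := by
  have hw := memLp_top_comp_coord (Θ := Θ) hΘ (continuous_pow k).continuousOn hs
  have h := integrable_mul_bilin hw (innerSL ℝ) (memLp_gradH u) (memLp_gradH u)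
  refine h.congr (Filter.Eventually.of_forall fun x => ?_)
  simp only [← real_inner_self_eq_norm_sq]
  rfl

/-- The energy of `u = f v` controls the Dirichlet energy of `v`. -/
theorem energy_lower_bound (hΘ : IsOpen Θ) (hα : 0 < α) (hαβ : α < β)
    (hs : ∀ x ∈ Θ, x 0 ∈ Ioo α β) (hf : ContDiffOn ℝ 2 f (Icc α β))
    (hfpos : ∀ t ∈ Icc α β, 0 < f t)
    (hf1 : ∀ t ∈ Icc α β, α ^ k * f α ^ 2 ≤ t ^ k * f t ^ 2)
    (hm : ∀ t ∈ Icc α β,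
      m ≤ -(derivWithin (fun s : ℝ => s ^ k * derivWithin f (Icc α β) s) (Icc α β) t)
          / (t ^ k * f t)) (u : H10 Θ) :
    α ^ k * f α ^ 2 * (∫ x in Θ, ‖(f (x 0))⁻¹ • gradH u x
        + valH u x • gradient (fun y : EuclideanSpace ℝ (Fin n) => (f (y 0))⁻¹) x‖ ^ 2)
      + m * (∫ x in Θ, weight k x * valH u x ^ 2)
      ≤ ∫ x in Θ, weight k x * ‖gradH u x‖ ^ 2 := by
  have hs' : ∀ x ∈ Θ, x 0 ∈ Icc α β := fun x hx => Ioo_subset_Icc_self (hs x hx)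
  have hud := uniqueDiffOn_Icc hαβ
  have hf' : ContDiffOn ℝ 1 f (Icc α β) := hf.of_le (by norm_num)
  set f' := derivWithin f (Icc α β)
  have hg := contDiffOn_pow_mul_derivWithin (k := k) hαβ hf
  set g : ℝ → ℝ := fun s => s ^ k * f' s
  have hne : ∀ t ∈ Icc α β, f t ≠ 0 := fun t ht => (hfpos t ht).ne'
  have hh : ContDiffOn ℝ 1 (fun t => g t / f t) (Icc α β) := hg.div hf' hne
  have hw : ContDiffOn ℝ 1 (fun t => (f t)⁻¹) (Icc α β) := hf'.inv hne
  have hh' : ∀ t ∈ Icc α β, derivWithin (fun t => g t / f t) (Icc α β) t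
      = (derivWithin g (Icc α β) t * f t - g t * f' t) / f t ^ 2 := fun t ht =>
    derivWithin_fun_div (hg.differentiableOn (by norm_num) t ht)
      (hf'.differentiableOn (by norm_num) t ht) (hne t ht)
  have hw' : ∀ t ∈ Icc α β, derivWithin (fun t => (f t)⁻¹) (Icc α β) t = -f' t / f t ^ 2 :=
    fun t ht => ((hf'.differentiableOn (by norm_num) t ht).hasDerivWithinAt.fun_inv
      (hne t ht)).derivWithin (hud t ht)
  set e : EuclideanSpace ℝ (Fin n) := EuclideanSpace.single 0 1
  have he : ‖e‖ = 1 := by simp [e]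
  have hWb := memLp_top_comp_coord (Θ := Θ) hΘ hh.continuousOn hs'
  have hWg := memLp_top_gradient_comp_coord (Θ := Θ) hΘ hαβ hh hs
  have hWb' : MemLp (fun x => ⟪gradient (fun y : EuclideanSpace ℝ (Fin n) =>
      g (y 0) / f (y 0)) x, e⟫_ℝ) ⊤ (volume.restrict Θ) := by
    have := (innerSL ℝ e).comp_memLp' hWg
    simpa [Function.comp_def, real_inner_comm] using this
  have hzero := integral_deriv_mul_sq_eq_zero hΘ (contDiffOn_comp_coord hh hs') hWb e hWb' u
  have i1 := (integrable_mul_bilin hWb (mulInner e) (memLp_valH u) (memLp_gradH u)).const_mul 2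
  simp only [mulInner_apply] at i1
  have i2 := integrable_mul_bilin hWb' (ContinuousLinearMap.mul ℝ ℝ) (memLp_valH u) (memLp_valH u)
  simp only [ContinuousLinearMap.mul_apply'] at i2
  have hv : MemLp (fun x => (f (x 0))⁻¹ • gradH u x
      + valH u x • gradient (fun y : EuclideanSpace ℝ (Fin n) => (f (y 0))⁻¹) x) 2
      (volume.restrict Θ) :=
    ((memLp_gradH u).smul (memLp_top_comp_coord (Θ := Θ) hΘ hw.continuousOn hs')).add
      ((memLp_top_gradient_comp_coord (Θ := Θ) hΘ hαβ hw hs).smul (memLp_valH u))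
  have i3 := (hv.integrable_norm_pow (by norm_num)).const_mul (α ^ k * f α ^ 2)
  have i4 := (integrable_weight_mul_sq (k := k) hΘ hs' u).const_mul m
  rw [← integral_const_mul] at hzero
  rw [← integral_add i1 i2] at hzero
  have hsum := integral_add (i3.add i4) (i1.add i2)
  simp only [Pi.add_apply] at hsum
  -- The vanishing integral of `∂₁((g/f) u²)` is added to the left side, so that the inequality can
  -- be proved pointwise.
  rw [← integral_const_mul, ← integral_const_mul, ← integral_add i3 i4, ← add_zero (∫ x in Θ, _),
    ← hzero, ← hsum]
  refine setIntegral_mono_on ((i3.add i4).add (i1.add i2))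
    (integrable_weight_mul_norm_sq hΘ hs' u) hΘ.measurableSet fun x hx => ?_
  have ht := hs' x hx
  have hFpos := hfpos _ ht
  have htpos : 0 < x 0 := hα.trans_le ht.1
  have hid := picone_identity (gradH u x) e he (valH u x) (weight k x) (f (x 0)) (f' (x 0))
    (derivWithin g (Icc α β) (x 0)) (pow_pos htpos k).ne' hFpos.ne'
  rw [hid, (hasGradientAt_comp_coord hw (hs x hx)).gradient,
    (hasGradientAt_comp_coord hh (hs x hx)).gradient, hw' _ ht, hh' _ ht, real_inner_smul_left,
    real_inner_self_eq_norm_sq, he]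
  have b1 := mul_le_mul_of_nonneg_right (hf1 _ ht)
    (sq_nonneg ‖(f (x 0))⁻¹ • gradH u x + valH u x • (-f' (x 0) / f (x 0) ^ 2) • e‖)
  have b2 := mul_le_mul_of_nonneg_right (hm _ ht)
    (show 0 ≤ x 0 ^ k * valH u x ^ 2 by positivity)
  simp only [weight, g] at b1 b2 ⊢
  linarith

theorem eq_zero_of_weighted_integrals_eq_zero (hΘ : IsOpen Θ) (hs : ∀ x ∈ Θ, x 0 ∈ Icc α β)
    (hw : ∀ x ∈ Θ, 0 < weight k x) {u : H10 Θ}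
    (hB : ∫ x in Θ, weight k x * valH u x ^ 2 = 0)
    (hA : ∫ x in Θ, weight k x * ‖gradH u x‖ ^ 2 = 0) : u = 0 := by
  have hae := ae_restrict_mem (μ := volume) hΘ.measurableSet
  have hv : valH u =ᵐ[volume.restrict Θ] 0 := by
    have h := (integral_eq_zero_iff_of_nonneg_ae
      (hae.mono fun x hx => mul_nonneg (hw x hx).le (sq_nonneg _))
      (integrable_weight_mul_sq (k := k) hΘ hs u)).1 hB
    filter_upwards [h, hae] with x hx hxΘ
    have := (hw x hxΘ).ne'
    simpa [this] using hx
  have hg : gradH u =ᵐ[volume.restrict Θ] 0 := by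
    have h := (integral_eq_zero_iff_of_nonneg_ae
      (hae.mono fun x hx => mul_nonneg (hw x hx).le (sq_nonneg _))
      (integrable_weight_mul_norm_sq (k := k) hΘ hs u)).1 hA
    filter_upwards [h, hae] with x hx hxΘ
    have := (hw x hxΘ).ne'
    simpa [this] using hx
  exact Subtype.ext (Prod.ext ((Lp.eq_zero_iff_ae_eq_zero).2 hv)
    ((Lp.eq_zero_iff_ae_eq_zero).2 hg))

/-- On the Nehari manifold below the threshold `m` the energy is at least the Sobolev level. -/
theorem sobolev_level_le_of_mem_nehari (hn : 3 ≤ n) (hΘ : IsOpen Θ)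
    [IsFiniteMeasure (volume.restrict Θ)] (hα : 0 < α) (hαβ : α < β)
    (hs : ∀ x ∈ Θ, x 0 ∈ Ioo α β) (hf : ContDiffOn ℝ 2 f (Icc α β))
    (hfpos : ∀ t ∈ Icc α β, 0 < f t)
    (hf1 : ∀ t ∈ Icc α β, α ^ k * f α ^ 2 ≤ t ^ k * f t ^ 2)
    (hf2 : ∀ t ∈ Icc α β, t ^ k * f t ^ critExp n ≤ α ^ k * f α ^ critExp n)
    (hm : ∀ t ∈ Icc α β,
      m ≤ -(derivWithin (fun s : ℝ => s ^ k * derivWithin f (Icc α β) s) (Icc α β) t)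
          / (t ^ k * f t)) {lam : ℝ} (hlam : lam < m) {u : H10 Θ}
    (hu : u ∈ nehari Θ (weight k) (weight k) (weight k) lam) :
    1 / n * (α ^ k * sobolevConst n ^ ((n : ℝ) / 2))
      ≤ J Θ (weight k) (weight k) (weight k) lam u := by
  have hnpos : (0 : ℝ) < n := by exact_mod_cast (by omega : 0 < n)
  have hp2 := two_lt_critExp hn
  have hp : 0 < critExp n := by linarith
  have hs' : ∀ x ∈ Θ, x 0 ∈ Icc α β := fun x hx => Ioo_subset_Icc_self (hs x hx)
  have hwpos : ∀ x ∈ Θ, 0 < weight k x := fun x hx => pow_pos (hα.trans_le (hs' x hx).1) k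
  have hα' : α ∈ Icc α β := left_mem_Icc.2 hαβ.le
  have hfα := hfpos α hα'
  rw [J_eq_of_mem_nehari hn hu]
  refine mul_le_mul_of_nonneg_left ?_ (by positivity)
  have hneh := nehari_identity hp.ne' hu
  have hen := energy_lower_bound hΘ hα hαβ hs hf hfpos hf1 hm u
  obtain ⟨W, hW⟩ : ∃ W : EuclideanSpace ℝ (Fin n) → ℝ, W = fun y => (f (y 0))⁻¹ := ⟨_, rfl⟩
  have hWx : ∀ x, (f (x 0))⁻¹ = W x := fun x => by rw [hW]
  simp only [hWx] at hen
  obtain ⟨D, hD⟩ : ∃ D, D = ∫ x in Θ, weight k x * |valH u x| ^ critExp n := ⟨_, rfl⟩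
  obtain ⟨B, hB⟩ : ∃ B, B = ∫ x in Θ, weight k x * valH u x ^ 2 := ⟨_, rfl⟩
  obtain ⟨A, hA⟩ : ∃ A, A = ∫ x in Θ, weight k x * ‖gradH u x‖ ^ 2 := ⟨_, rfl⟩
  obtain ⟨X, hX⟩ : ∃ X, X = ∫ x in Θ, ‖W x • gradH u x + valH u x • gradient W x‖ ^ 2 :=
    ⟨_, rfl⟩
  rw [← hA, ← hB, ← hX] at hen
  rw [← hA, ← hB, ← hD] at hneh
  rw [← hD]
  have hX0 : 0 ≤ X := hX ▸ integral_nonneg fun x => by positivity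
  have hae := ae_restrict_mem (μ := volume) hΘ.measurableSet
  have hB0 : 0 ≤ B := hB ▸ setIntegral_nonneg hΘ.measurableSet fun x hx => by
    have := hwpos x hx
    positivity
  have hD0 : 0 ≤ D := hD ▸ setIntegral_nonneg hΘ.measurableSet fun x hx => by
    have := hwpos x hx
    positivity
  have hmB : lam * B ≤ m * B := mul_le_mul_of_nonneg_right hlam.le hB0
  have hDX : α ^ k * f α ^ 2 * X ≤ D := by linarith
  have hcX : 0 ≤ α ^ k * f α ^ 2 * X := by positivity
  -- If `D = 0`, the Nehari identity and the energy bound give `(m - λ) B ≤ 0`, so `B = 0`, then `A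
  -- = 0` and `u = 0`.
  have hDpos : 0 < D := by
    refine lt_of_le_of_ne hD0 fun hD' => hu.1 ?_
    have hB' : B = 0 := by
      by_contra hB'
      have : 0 < B := lt_of_le_of_ne hB0 (Ne.symm hB')
      nlinarith
    have hA' : A = 0 := by rw [hB'] at hneh; linarith
    exact eq_zero_of_weighted_integrals_eq_zero hΘ hs' hwpos (hB ▸ hB') (hA ▸ hA')
  have hne : ∀ t ∈ Icc α β, f t ≠ 0 := fun t ht => (hfpos t ht).ne'
  have hw : ContDiffOn ℝ 1 (fun t => (f t)⁻¹) (Icc α β) := (hf.of_le (by norm_num)).inv hne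
  have hWu : ¬ (fun x => W x * valH u x) =ᵐ[volume.restrict Θ] 0 := by
    intro h
    refine hDpos.ne' ?_
    have : (fun x => weight k x * |valH u x| ^ critExp n) =ᵐ[volume.restrict Θ] 0 := by
      filter_upwards [h, hae] with x hx hxΘ
      have h0 : valH u x = 0 := by
        simpa [hW, hne _ (hs' x hxΘ)] using hx
      simp [h0, Real.zero_rpow hp.ne']
    rw [hD]
    simpa using integral_congr_ae this
  have hW1 : ContDiffOn ℝ 1 W Θ := hW ▸ contDiffOn_comp_coord hw hs'
  have hW2 : MemLp W ⊤ (volume.restrict Θ) := hW ▸ memLp_top_comp_coord hΘ hw.continuousOn hs'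
  have hW3 : MemLp (gradient W) ⊤ (volume.restrict Θ) :=
    hW ▸ memLp_top_gradient_comp_coord hΘ hαβ hw hs
  have hSob := sobolevConst_le_quotient hΘ hp.ne' hW1 hW2 hW3 u hWu
  obtain ⟨P, hP⟩ : ∃ P, P = ∫ x in Θ, |W x * valH u x| ^ critExp n := ⟨_, rfl⟩
  rw [← hX, ← hP] at hSob
  have hP0 : 0 ≤ P := hP ▸ integral_nonneg fun x => by positivity
  -- If `S = 0` the bound is trivial, so positivity of the Sobolev constant need not be proved.
  rcases (sobolevConst_nonneg n).eq_or_lt with hS | hS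
  · rw [← hS, Real.zero_rpow (by positivity), mul_zero]
    exact hD0
  -- If `P = 0`, the quotient in `hSob` is a division by zero, hence `0`, contradicting `S > 0`.
  have hPpos : 0 < P := by
    refine lt_of_le_of_ne hP0 fun h => ?_
    rw [← h, Real.zero_rpow (by positivity), div_zero] at hSob
    linarith
  -- A non-integrable function has integral `0` by convention, so `P > 0` already forces
  -- integrability without the Sobolev embedding.
  have hPint : Integrable (fun x => |W x * valH u x| ^ critExp n) (volume.restrict Θ) := by
    by_contra h
    exact hPpos.ne' (hP.trans (integral_undef h))
  have hDP : D ≤ α ^ k * f α ^ critExp n * P := by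
    rw [hD, hP, ← integral_const_mul]
    refine integral_mono_of_nonneg ?_ (hPint.const_mul _) ?_
    · filter_upwards [hae] with x hx
      have := hwpos x hx
      simp only [Pi.zero_apply]
      positivity
    · filter_upwards [hae] with x hx
      have hF := hfpos _ (hs' x hx)
      have h := mul_le_mul_of_nonneg_right (hf2 _ (hs' x hx))
        (show 0 ≤ |W x * valH u x| ^ critExp n by positivity)
      refine le_of_eq_of_le ?_ h
      have hu' : |valH u x| = f (x 0) * |W x * valH u x| := by
        rw [abs_mul, abs_of_pos (show 0 < W x from hWx x ▸ inv_pos.2 hF), ← mul_assoc,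
          show f (x 0) * W x = 1 by rw [← hWx, mul_inv_cancel₀ hF.ne'], one_mul]
      rw [hu', Real.mul_rpow hF.le (abs_nonneg _), weight]
      ring
  refine mul_rpow_le_of_sobolev_bounds hnpos hp ?_ (pow_pos hα k) hfα hS.le hP0 hDpos hDX ?_ hDP
  · have := one_div_critExp hn
    rw [show 2 / critExp n = 2 * (1 / critExp n) by ring, this]
    ring
  · rwa [le_div_iff₀ (by positivity)] at hSob

end Main

end AnisoCrit

theorem lemma4p2 (n k : ℕ) [NeZero n] (hn : 3 ≤ n) (hk : 1 ≤ k)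
    (Θ : Set (EuclideanSpace ℝ (Fin n))) (hΘ : AnisoCrit.IsBoundedSmoothDomain Θ)
    (hpos : ∀ x ∈ closure Θ, 0 < x 0)
    (α β : ℝ)
    (hα : IsLeast ((fun x : EuclideanSpace ℝ (Fin n) => x 0) '' closure Θ) α)
    (hβ : IsGreatest ((fun x : EuclideanSpace ℝ (Fin n) => x 0) '' closure Θ) β)
    (f : ℝ → ℝ) (hf : ContDiffOn ℝ 2 f (Set.Icc α β))
    (hfpos : ∀ t ∈ Set.Icc α β, 0 < f t)
    (hf1 : ∀ t ∈ Set.Icc α β, α ^ k * f α ^ 2 ≤ t ^ k * f t ^ 2)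
    (hf2 : ∀ t ∈ Set.Icc α β,
      t ^ k * f t ^ AnisoCrit.critExp n ≤ α ^ k * f α ^ AnisoCrit.critExp n) :
    ∃ m : ℝ,
      IsLeast ((fun t : ℝ =>
        -(derivWithin (fun s : ℝ => s ^ k * derivWithin f (Set.Icc α β) s) (Set.Icc α β) t)
          / (t ^ k * f t)) '' Set.Icc α β) m ∧
      (m : EReal) ≤ AnisoCrit.lambdaZeroStarK Θ k := by
  have hs' : ∀ x ∈ Θ, x 0 ∈ Set.Icc α β := fun x hx =>
    ⟨hα.2 ⟨x, subset_closure hx, rfl⟩, hβ.2 ⟨x, subset_closure hx, rfl⟩⟩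
  have hs := AnisoCrit.coord_mem_Ioo hΘ.isOpen hs'
  obtain ⟨x₀, hx₀⟩ := hΘ.isConnected.nonempty
  -- Strictness makes `Icc α β` a set of unique differentiability, as the `derivWithin` calculus
  -- requires.
  have hαβ : α < β := (hs x₀ hx₀).1.trans (hs x₀ hx₀).2
  obtain ⟨y, hy, hyα⟩ := hα.1
  simp only at hyα
  have hαpos : 0 < α := hyα ▸ hpos y hy
  have hcont : ContinuousOn (fun t : ℝ =>
      -(derivWithin (fun s : ℝ => s ^ k * derivWithin f (Set.Icc α β) s) (Set.Icc α β) t)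
          / (t ^ k * f t)) (Set.Icc α β) := by
    refine ContinuousOn.div ?_ ((continuous_pow k).continuousOn.mul hf.continuousOn) ?_
    · exact ((AnisoCrit.contDiffOn_pow_mul_derivWithin hαβ hf).continuousOn_derivWithin
        (uniqueDiffOn_Icc hαβ) le_rfl).neg
    · intro t ht
      exact (mul_pos (pow_pos (hαpos.trans_le ht.1) k) (hfpos t ht)).ne'
  obtain ⟨m, hm⟩ := (isCompact_Icc.image_of_continuousOn hcont).exists_isLeast
    ((Set.nonempty_Icc.2 hαβ.le).image _)
  refine ⟨m, hm, le_sInf ?_⟩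
  rintro _ ⟨lam, ⟨-, hell⟩, rfl⟩
  -- Contrapositive: `λ < m` would force `κ ≤ ℓ_λ`.
  refine EReal.coe_le_coe_iff.2 (not_lt.1 fun hlam => hell.not_ge ?_)
  have : IsFiniteMeasure (volume.restrict Θ) :=
    ⟨by simpa using hΘ.isBounded.measure_lt_top⟩
  refine le_iInf₂ fun u hu => EReal.coe_le_coe_iff.2 ?_
  refine (AnisoCrit.kappa_weight_le hpos hy).trans ?_
  rw [hyα]
  exact AnisoCrit.sobolev_level_le_of_mem_nehari hn hΘ.isOpen hαpos hαβ hs hf hfpos hf1 hf2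
    (fun t ht => hm.2 ⟨t, ht, rfl⟩) hlam hu
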